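/- A monotone triangle with $n$ rows is a triangular array $(a_{i,j})_{1\le j\le i\le n}$ of integers such that $a_{i,j}\le a_{i-1,j}\le a_{i,j+1}$ and $a_{i,j}<a_{i,j+1}$ whenever these entries are defined; its bottom row is $(a_{n,1},\dots,a_{n,n})$. For integers $k_1<k_2<\dots<k_n$, the number of monotone triangles with $n$ rows and bottom row $(k_1,\dots,k_n)$ is finite and equal to $$\left.\left[\left(\prod_{1\le p<q\le n}\bigl(\operatorname{id}+E_{x_p}\Delta_{x_q}\bigr)\right)\prod_{1\le i<j\le n}\frac{x_j-x_i}{j-i}\right]\right|_{(x_1,\dots,x_n)=(k_1,\dots,k_n)},$$ where $E_{x}$ is the shift operator on polynomials, defined by $E_x\,p(x)=p(x+1)$ (the other variables being unchanged), $\Delta_x=E_x-\operatorname{id}$ is the difference operator, and the product of operators is their composition (the factors commute, so the order does not matter). -/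

import Mathlib

/-- A monotone triangle with `n` rows: a triangular array of integers whose row number `i`
(counted from `0`, from top to bottom) has `i + 1` entries, which is strictly increasing along
rows and weakly increasing in northeast and in southeast direction. -/
@[ext]
structure MonotoneTriangle (n : ℕ) where
  /-- `entry i j` is the `j`-th entry of the `i`-th row (both counted from `0`). -/
  entry : (i : Fin n) → Fin ((i : ℕ) + 1) → ℤ
  row_lt : ∀ (i : Fin n) (j : Fin (i : ℕ)), entry i j.castSucc < entry i j.succ
  northeast : ∀ (i : ℕ) (h : i + 1 < n) (j : Fin (i + 1)),
    entry ⟨i + 1, h⟩ j.castSucc ≤ entry ⟨i, Nat.lt_of_succ_lt h⟩ j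
  southeast : ∀ (i : ℕ) (h : i + 1 < n) (j : Fin (i + 1)),
    entry ⟨i, Nat.lt_of_succ_lt h⟩ j ≤ entry ⟨i + 1, h⟩ j.succ

/-- The set of monotone triangles with `n` rows whose bottom row (the row with `n` entries)
is `k`. -/
def monotoneTriangles (n : ℕ) (k : Fin n → ℤ) : Set (MonotoneTriangle n) :=
  {T | ∀ (i : Fin n) (h : (i : ℕ) + 1 = n) (j : Fin ((i : ℕ) + 1)),
    T.entry i j = k (Fin.cast h j)}

/-- The shift operator `E_{x_i}` on `ℚ[x_1, …, x_n]`: it replaces the variable `x_i` by `x_i + 1`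
and leaves the other variables unchanged. -/
noncomputable def shiftOp {n : ℕ} (i : Fin n) : Module.End ℚ (MvPolynomial (Fin n) ℚ) :=
  (MvPolynomial.aeval
    (fun j : Fin n => if j = i then MvPolynomial.X j + 1 else MvPolynomial.X j) :
      MvPolynomial (Fin n) ℚ →ₐ[ℚ] MvPolynomial (Fin n) ℚ).toLinearMap

/-- The difference operator `Δ_{x_i} = E_{x_i} - id`. -/
noncomputable def diffOp {n : ℕ} (i : Fin n) : Module.End ℚ (MvPolynomial (Fin n) ℚ) :=
  shiftOp i - 1

theorem shiftOp_commute {n : ℕ} (i j : Fin n) : Commute (shiftOp i) (shiftOp j) := by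
  unfold shiftOp Commute SemiconjBy
  rw [Module.End.mul_eq_comp, Module.End.mul_eq_comp, ← AlgHom.comp_toLinearMap,
    ← AlgHom.comp_toLinearMap]
  congr 1
  apply MvPolynomial.algHom_ext
  intro l
  by_cases h1 : l = i <;> by_cases h2 : l = j <;> simp [h1, h2] <;> split_ifs <;> simp_all

/-- The operator `id + E_{x_p} Δ_{x_q}`; the product of operators is the composition. -/
noncomputable def factorOp {n : ℕ} (p q : Fin n) : Module.End ℚ (MvPolynomial (Fin n) ℚ) :=
  1 + shiftOp p * diffOp q

theorem factorOp_commute {n : ℕ} (p q r s : Fin n) :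
    Commute (factorOp p q) (factorOp r s) := by
  have hd : ∀ i j : Fin n, Commute (shiftOp i) (diffOp j) := fun i j =>
    (shiftOp_commute i j).sub_right (Commute.one_right _)
  have hdd : Commute (diffOp q) (diffOp s) := (hd q s).sub_left (Commute.one_left _)
  have h : Commute (shiftOp p * diffOp q) (shiftOp r * diffOp s) :=
    ((shiftOp_commute p r).mul_right (hd p s)).mul_left
      ((hd r q).symm.mul_right hdd)
  exact (Commute.one_left _).add_left ((Commute.one_right _).add_right h)

/-- The index pairs `(p, q)` with `p < q`. -/
def indexPairs (n : ℕ) : Finset (Fin n × Fin n) :=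
  Finset.univ.filter (fun e => e.1 < e.2)

/-- The operator `∏_{p < q} (id + E_{x_p} Δ_{x_q})`. The factors commute, so their composition
does not depend on the order. -/
noncomputable def productOp (n : ℕ) : Module.End ℚ (MvPolynomial (Fin n) ℚ) :=
  (indexPairs n).noncommProd (fun e => factorOp e.1 e.2)
    (fun a _ b _ _ => factorOp_commute a.1 a.2 b.1 b.2)

/-- The polynomial `∏_{i < j} (x_j - x_i) / (j - i)` in `ℚ[x_1, …, x_n]`. -/
noncomputable def vandermondeQuotient (n : ℕ) : MvPolynomial (Fin n) ℚ :=
  ∏ e ∈ indexPairs n,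
    MvPolynomial.C (1 / (((e.2 : ℕ) : ℚ) - ((e.1 : ℕ) : ℚ))) *
      (MvPolynomial.X e.2 - MvPolynomial.X e.1)

/-! ### Constant coefficient difference operators on functions on lattices -/

/-! Both sides satisfy the same recursion: delete the bottom row of a triangle and sum over the
strict rows `l` interlacing with `k` (`image_init_monotoneTriangles`,
`shiftProduct_chooseDet_succ`).

Write `P_m` for `shiftProduct m` and `D_s` for `chooseDet s m`, the determinant of the binomials
`x_i` over `j + s`. At lattice points the Vandermonde quotient is `D_0`, and by Pascal's rule `D_0`
is the product of all differences applied to `D_1`. Hence `P_m D_0` is that product applied to `G =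
P_m D_1`, and its sum over interlacing rows should telescope.

Strictness of `l` is the obstacle: a free sum over the intervals also contains rows with two equal
neighbours. The correction is controlled because `(1 + E_{i+1} Δ_i) G` vanishes where `x_i =
x_{i+1}`: this operator is the one factor missing from `P_m` for symmetry in `i` and `i + 1`, while
`D_1` is antisymmetric. So the sum collapses to an alternating sum of the values `G (skipShift j k)`
(`sum_interlacingRows_diffProduct`).

The same alternating sum arises from expanding the determinant of size `m + 1` along its column of
ones: on functions independent of `x_j`, `E_j` acts as the identity and `P_{m+1}` reduces to `P_m`
times the shifts `E_q` with `q > j` (`mapDomain_shiftProduct`). -/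

/-- The Laurent polynomial ring `ℚ[E_i^{±1} : i ∈ ι]`, as the group algebra of `ℤ^ι`. -/
abbrev ShiftRing (ι : Type*) : Type _ := AddMonoidAlgebra ℚ (ι → ℤ)

/-- Translations of functions on `ℤ^ι`. -/
def translationHom (ι : Type*) :
    Multiplicative (ι → ℤ) →* Module.End ℚ ((ι → ℤ) → ℚ) where
  toFun v :=
    { toFun := fun f x => f (x + v.toAdd)
      map_add' := fun _ _ => rfl
      map_smul' := fun _ _ => rfl }
  map_one' := by ext f x; simp
  map_mul' v w := by
    ext f x
    simp [add_left_comm, add_comm]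

/-- The action of the ring of shifts on functions on `ℤ^ι`. -/
noncomputable def shiftAction (ι : Type*) :
    ShiftRing ι →ₐ[ℚ] Module.End ℚ ((ι → ℤ) → ℚ) :=
  AddMonoidAlgebra.lift ℚ _ _ (translationHom ι)

theorem shiftAction_single {ι : Type*} (v : ι → ℤ) (c : ℚ) (f : (ι → ℤ) → ℚ) (x : ι → ℤ) :
    shiftAction ι (AddMonoidAlgebra.single v c) f x = c * f (x + v) := by
  simp [shiftAction, AddMonoidAlgebra.lift_single, translationHom]

/-- Equivariance of the action of shifts under additive maps between lattices, in both variances: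
`Ψ` transports functions and `θ` transports points. -/
theorem shiftAction_equivariant {ι κ : Type*} (φ : (ι → ℤ) →+ (κ → ℤ))
    (Ψ : ((κ → ℤ) → ℚ) → ((ι → ℤ) → ℚ)) (θ : (ι → ℤ) → (κ → ℤ))
    (hΨ : ∀ f x, Ψ f x = f (θ x)) (hθ : ∀ x v, θ (x + v) = θ x + φ v)
    (r : ShiftRing ι) (f : (κ → ℤ) → ℚ) (x : ι → ℤ) :
    shiftAction ι r (Ψ f) x =
      shiftAction κ (AddMonoidAlgebra.mapDomainRingHom ℚ φ r) f (θ x) := by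
  induction r using AddMonoidAlgebra.induction_linear with
  | zero => simp
  | add a b ha hb => simp only [map_add, LinearMap.add_apply, Pi.add_apply, ha, hb]
  | single v c =>
    have : AddMonoidAlgebra.mapDomainRingHom ℚ φ (AddMonoidAlgebra.single v c) =
        AddMonoidAlgebra.single (φ v) c := AddMonoidAlgebra.mapDomain_single
    rw [this, shiftAction_single, shiftAction_single, hΨ, hθ]

/-- Restriction of lattice points along a map of index sets. -/
def reindexHom {ι κ : Type*} (φ : κ → ι) : (ι → ℤ) →+ (κ → ℤ) where
  toFun x := x ∘ φ
  map_zero' := rfl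
  map_add' _ _ := rfl

/-- Used for deleting a coordinate (`φ = j.succAbove`) and for swapping two coordinates. -/
theorem shiftAction_reindex {ι κ : Type*} (φ : κ → ι) (r : ShiftRing ι)
    (f : (κ → ℤ) → ℚ) (x : ι → ℤ) :
    shiftAction ι r (fun y => f (y ∘ φ)) x =
      shiftAction κ (AddMonoidAlgebra.mapDomainRingHom ℚ (reindexHom φ) r) f (x ∘ φ) :=
  shiftAction_equivariant (reindexHom φ) (fun f y => f (y ∘ φ)) (fun y => y ∘ φ)
    (fun _ _ => rfl) (fun _ _ => rfl) r f x

/-- The inclusion of lattices that puts a zero in front. -/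
def consZeroHom (m : ℕ) : (Fin m → ℤ) →+ (Fin (m + 1) → ℤ) where
  toFun x := Fin.cons 0 x
  map_zero' := by
    ext i
    refine Fin.cases ?_ (fun i => ?_) i <;> simp
  map_add' x y := by
    ext i
    refine Fin.cases ?_ (fun i => ?_) i <;> simp

/-- Freezes the first coordinate. The points move along an affine map with constant `c`, but only
its linear part `consZeroHom` acts on the shifts. -/
theorem shiftAction_cons {m : ℕ} (r : ShiftRing (Fin m)) (f : (Fin (m + 1) → ℤ) → ℚ)
    (c : ℤ) (x : Fin m → ℤ) :
    shiftAction _ (AddMonoidAlgebra.mapDomainRingHom ℚ (consZeroHom m) r) f (Fin.cons c x) =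
      shiftAction _ r (fun y => f (Fin.cons c y)) x := by
  refine (shiftAction_equivariant (consZeroHom m) (fun f y => f (Fin.cons c y))
    (fun y => Fin.cons c y) (fun _ _ => rfl) (fun x v => ?_) r f x).symm
  ext i
  refine Fin.cases ?_ (fun i => ?_) i <;> simp [consZeroHom]

/-- The shift `E_i` as an element of the ring of shifts. -/
noncomputable def shiftVar {ι : Type*} [DecidableEq ι] (i : ι) : ShiftRing ι :=
  AddMonoidAlgebra.single (Pi.single i 1) 1

/-- The factor `1 + E_p (E_q - 1)` in the ring of shifts. -/
noncomputable def shiftFactor {ι : Type*} [DecidableEq ι] (p q : ι) : ShiftRing ι :=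
  1 + shiftVar p * (shiftVar q - 1)

theorem shiftAction_shiftVar {ι : Type*} [DecidableEq ι] (i : ι) (f : (ι → ℤ) → ℚ)
    (x : ι → ℤ) : shiftAction ι (shiftVar i) f x = f (x + Pi.single i 1) := by
  rw [shiftVar, shiftAction_single, one_mul]

theorem shiftAction_prod_shiftVar {ι : Type*} [DecidableEq ι] (s : Finset ι)
    (f : (ι → ℤ) → ℚ) (x : ι → ℤ) :
    shiftAction ι (∏ i ∈ s, shiftVar i) f x = f (x + fun i => if i ∈ s then 1 else 0) := by
  induction s using Finset.induction_on generalizing x with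
  | empty =>
    have : (fun _ : ι => (0 : ℤ)) = 0 := rfl
    simp [this]
  | insert a s ha ih =>
    rw [Finset.prod_insert ha, map_mul, Module.End.mul_apply, shiftAction_shiftVar, ih, add_assoc]
    congr 2
    ext i
    by_cases h : i = a
    · subst h; simp [ha]
    · simp [h]

theorem shiftAction_shiftFactor {ι : Type*} [DecidableEq ι] (p q : ι) (f : (ι → ℤ) → ℚ)
    (x : ι → ℤ) : shiftAction ι (shiftFactor p q) f x =
      f x + f (x + Pi.single p 1 + Pi.single q 1) - f (x + Pi.single p 1) := by
  simp only [shiftFactor, map_add, map_mul, map_sub, map_one, LinearMap.add_apply,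
    Module.End.mul_apply, Pi.add_apply, LinearMap.sub_apply, Module.End.one_apply,
    shiftAction_shiftVar, Pi.sub_apply]
  ring

/-- The product `∏_{p < q} (1 + E_p (E_q - 1))` in the ring of shifts. -/
noncomputable def shiftProduct (n : ℕ) : ShiftRing (Fin n) :=
  ∏ e ∈ indexPairs n, shiftFactor e.1 e.2

/-! ### Images of shifts and factors under maps of lattices. -/

theorem mapDomain_shiftVar {ι κ : Type*} [DecidableEq ι] [DecidableEq κ]
    (φ : (ι → ℤ) →+ (κ → ℤ)) (i : ι) (v : κ → ℤ) (h : φ (Pi.single i 1) = v) :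
    AddMonoidAlgebra.mapDomainRingHom ℚ φ (shiftVar i) = AddMonoidAlgebra.single v 1 := by
  rw [← h]
  exact AddMonoidAlgebra.mapDomain_single

theorem mapDomain_shiftFactor {ι κ : Type*} [DecidableEq ι] (φ : (ι → ℤ) →+ (κ → ℤ)) (p q : ι) :
    AddMonoidAlgebra.mapDomainRingHom ℚ φ (shiftFactor p q) =
      1 + AddMonoidAlgebra.mapDomainRingHom ℚ φ (shiftVar p) *
        (AddMonoidAlgebra.mapDomainRingHom ℚ φ (shiftVar q) - 1) := by
  simp only [shiftFactor, map_add, map_mul, map_sub, map_one]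

theorem mapDomain_reindex_succAbove_self {n : ℕ} (j : Fin (n + 1)) :
    AddMonoidAlgebra.mapDomainRingHom ℚ (reindexHom j.succAbove) (shiftVar j) = 1 := by
  refine mapDomain_shiftVar _ _ 0 ?_
  ext i
  simp [reindexHom, Fin.succAbove_ne]

theorem mapDomain_reindex_succAbove {n : ℕ} (j : Fin (n + 1)) (i : Fin n) :
    AddMonoidAlgebra.mapDomainRingHom ℚ (reindexHom j.succAbove) (shiftVar (j.succAbove i)) =
      shiftVar i := by
  refine mapDomain_shiftVar _ _ _ ?_
  ext k
  simp [reindexHom, Pi.single_apply]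

theorem mapDomain_reindex_perm {ι : Type*} [DecidableEq ι] (σ : Equiv.Perm ι) (i : ι) :
    AddMonoidAlgebra.mapDomainRingHom ℚ (reindexHom σ) (shiftVar i) = shiftVar (σ.symm i) := by
  refine mapDomain_shiftVar _ _ _ ?_
  ext k
  simp [reindexHom, Pi.single_apply, Equiv.eq_symm_apply]

theorem mapDomain_consZeroHom {m : ℕ} (i : Fin m) :
    AddMonoidAlgebra.mapDomainRingHom ℚ (consZeroHom m) (shiftVar i) = shiftVar i.succ := by
  refine mapDomain_shiftVar _ _ _ ?_
  ext k
  refine Fin.cases ?_ (fun k => ?_) k <;> simp [consZeroHom, Pi.single_apply, Fin.succ_inj]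

/-- Setting `E_j = 1` turns the factors `1 + E_p (E_j - 1)` into `1` and the factors `1 + E_j (E_q -
1)` into `E_q`; the others are those of the smaller product. -/
theorem mapDomain_shiftProduct {n : ℕ} (j : Fin (n + 1)) :
    AddMonoidAlgebra.mapDomainRingHom ℚ (reindexHom j.succAbove) (shiftProduct (n + 1)) =
      (∏ i ∈ Finset.univ.filter (fun i : Fin n => j < j.succAbove i), shiftVar i) *
        shiftProduct n := by
  have key (n : ℕ) : shiftProduct n =
      ∏ p : Fin n, ∏ q : Fin n, if p < q then shiftFactor p q else 1 := by
    rw [shiftProduct, indexPairs, Finset.prod_filter, ← Finset.univ_product_univ,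
      Finset.prod_product]
  rw [key, key, Fin.prod_univ_succAbove _ j, map_mul, Fin.prod_univ_succAbove _ j]
  simp only [lt_irrefl, if_false, one_mul]
  rw [map_prod, map_prod, Finset.prod_filter]
  congr 1
  · refine Finset.prod_congr rfl fun q _ => ?_
    split_ifs
    · rw [mapDomain_shiftFactor, mapDomain_reindex_succAbove_self, mapDomain_reindex_succAbove]
      ring
    · simp
  · refine Finset.prod_congr rfl fun p _ => ?_
    rw [Fin.prod_univ_succAbove _ j, map_mul, map_prod]
    have : AddMonoidAlgebra.mapDomainRingHom ℚ (reindexHom j.succAbove)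
        (if j.succAbove p < j then shiftFactor (j.succAbove p) j else 1) = 1 := by
      split_ifs
      · rw [mapDomain_shiftFactor, mapDomain_reindex_succAbove_self]
        ring
      · simp
    rw [this, one_mul]
    refine Finset.prod_congr rfl fun q _ => ?_
    simp only [Fin.succAbove_lt_succAbove_iff]
    split_ifs
    · rw [mapDomain_shiftFactor, mapDomain_reindex_succAbove, mapDomain_reindex_succAbove, shiftFactor]
    · simp

/-- Multiplying by the one missing factor `1 + E_{i+1} (E_i - 1)` makes the product symmetric in
the variables `i` and `i + 1`. -/
theorem mapDomain_swap_shiftFactor_mul {m : ℕ} (i : Fin m) :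
    AddMonoidAlgebra.mapDomainRingHom ℚ
        (reindexHom (Equiv.swap i.castSucc i.succ))
        (shiftFactor i.succ i.castSucc * shiftProduct (m + 1)) =
      shiftFactor i.succ i.castSucc * shiftProduct (m + 1) := by
  have hnot : (i.succ, i.castSucc) ∉ indexPairs (m + 1) := by
    simp [indexPairs, Fin.le_def]
  have hins : shiftFactor i.succ i.castSucc * shiftProduct (m + 1) =
      ∏ e ∈ insert (i.succ, i.castSucc) (indexPairs (m + 1)), shiftFactor e.1 e.2 := by
    rw [Finset.prod_insert hnot, shiftProduct]
  -- An adjacent transposition reverses the order of only one pair `p < q`, namely `(i, i + 1)`, and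
  -- it exchanges this pair with the inserted one.
  have hmem : ∀ e : Fin (m + 1) × Fin (m + 1),
      e ∈ insert (i.succ, i.castSucc) (indexPairs (m + 1)) →
      (Equiv.swap i.castSucc i.succ e.1, Equiv.swap i.castSucc i.succ e.2) ∈
        insert (i.succ, i.castSucc) (indexPairs (m + 1)) := by
    rintro ⟨p, q⟩ h
    simp only [indexPairs, Finset.mem_insert, Prod.mk.injEq, Finset.mem_filter, Finset.mem_univ,
      true_and, Fin.ext_iff, Fin.lt_def, Equiv.swap_apply_def, Fin.val_succ,
      Fin.val_castSucc] at h ⊢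
    split_ifs <;> simp_all <;> omega
  rw [hins, map_prod]
  refine Finset.prod_bij' (fun e _ => (Equiv.swap i.castSucc i.succ e.1,
    Equiv.swap i.castSucc i.succ e.2)) (fun e _ => (Equiv.swap i.castSucc i.succ e.1,
    Equiv.swap i.castSucc i.succ e.2)) (fun e he => hmem e he) (fun e he => hmem e he)
    (fun e _ => by simp) (fun e _ => by simp) (fun e _ => ?_)
  rw [mapDomain_shiftFactor, mapDomain_reindex_perm, mapDomain_reindex_perm, Equiv.symm_swap,
    shiftFactor]

/-- If `F` is antisymmetric, then `1 + E_{i+1} (E_i - 1)` turns `∏_{p < q} (1 + E_p (E_q - 1)) F`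
into a function that vanishes where the coordinates `i` and `i + 1` agree. -/
theorem shiftFactor_shiftProduct_eq_zero {m : ℕ} (F : (Fin (m + 1) → ℤ) → ℚ) (i : Fin m)
    (hF : ∀ x, F (x ∘ Equiv.swap i.castSucc i.succ) = -F x) (x : Fin (m + 1) → ℤ)
    (hx : x i.castSucc = x i.succ) :
    shiftAction _ (shiftFactor i.succ i.castSucc) (shiftAction _ (shiftProduct (m + 1)) F) x =
      0 := by
  rw [← Module.End.mul_apply, ← map_mul]
  have h := shiftAction_reindex (Equiv.swap i.castSucc i.succ)
    (shiftFactor i.succ i.castSucc * shiftProduct (m + 1)) F x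
  -- At a fixed point of the swap, the value equals its own negative.
  have hxx : x ∘ Equiv.swap i.castSucc i.succ = x := by
    ext k
    simp only [Function.comp_apply, Equiv.swap_apply_def]
    split_ifs <;> simp_all
  have hFF : (fun y => F (y ∘ Equiv.swap i.castSucc i.succ)) = -F := funext hF
  rw [mapDomain_swap_shiftFactor_mul, hxx, hFF, map_neg, Pi.neg_apply] at h
  linarith

/-! ### The Vandermonde quotient as a determinant of binomial coefficients -/

/-- The determinant of the binomial coefficients `x_i` over `j + s`. -/
noncomputable def chooseDet (s m : ℕ) (x : Fin m → ℤ) : ℚ :=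
  (Matrix.of fun i j : Fin m => ((Ring.choose (x i) ((j : ℕ) + s) : ℤ) : ℚ)).det

theorem chooseDet_comp_perm (s : ℕ) {m : ℕ} (σ : Equiv.Perm (Fin m)) (x : Fin m → ℤ) :
    chooseDet s m (x ∘ σ) = (Equiv.Perm.sign σ : ℤ) * chooseDet s m x := by
  rw [chooseDet, chooseDet, ← Matrix.det_permute]
  rfl

/-- Column `0` consists of ones, and the remaining columns of each minor have their lower index
raised by one. -/
theorem chooseDet_succ {m : ℕ} (k : Fin (m + 1) → ℤ) :
    chooseDet 0 (m + 1) k =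
      ∑ j : Fin (m + 1), (-1) ^ (j : ℕ) * chooseDet 1 m (k ∘ j.succAbove) := by
  rw [chooseDet, Matrix.det_succ_column_zero]
  refine Finset.sum_congr rfl fun j _ => ?_
  simp only [Matrix.of_apply, Fin.val_zero, Nat.add_zero, Ring.choose_zero_right, Int.cast_one,
    mul_one, chooseDet]
  congr 2

/-- Each `x_a` occurs in row `a` only, so by multilinearity a difference in `x_a` is taken inside
that row. -/
theorem shiftAction_prod_sub_one_det {m : ℕ} (b c : Fin m → ℤ → ℚ)
    (hbc : ∀ j x, b j (x + 1) - b j x = c j x) (s : Finset (Fin m)) (x : Fin m → ℤ) :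
    shiftAction _ (∏ i ∈ s, (shiftVar i - 1))
        (fun y => (Matrix.of fun i j : Fin m => b j (y i)).det) x =
      (Matrix.of fun i j : Fin m => if i ∈ s then c j (x i) else b j (x i)).det := by
  induction s using Finset.induction_on generalizing x with
  | empty => simp
  | insert a s ha ih =>
    rw [Finset.prod_insert ha, map_mul, Module.End.mul_apply, map_sub, map_one,
      LinearMap.sub_apply, Pi.sub_apply, Module.End.one_apply, shiftAction_shiftVar, ih, ih]
    set M : Matrix (Fin m) (Fin m) ℚ :=
      Matrix.of fun i j : Fin m => if i ∈ s then c j (x i) else b j (x i) with hM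
    have h1 : (Matrix.of fun i j : Fin m => if i ∈ s then c j ((x + Pi.single a 1 : Fin m → ℤ) i)
        else b j ((x + Pi.single a 1 : Fin m → ℤ) i)) = M.updateRow a (fun j => b j (x a + 1)) := by
      ext i j
      by_cases h : i = a
      · subst h; simp [ha]
      · simp [h, hM]
    have h2 : M = M.updateRow a (fun j => b j (x a)) := by
      ext i j
      by_cases h : i = a
      · subst h; simp [ha, hM]
      · simp [h]
    have h3 : (Matrix.of fun i j : Fin m => if i ∈ insert a s then c j (x i) else b j (x i)) =
        M.updateRow a (fun j => c j (x a)) := by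
      ext i j
      by_cases h : i = a
      · subst h; simp
      · simp [h, hM]
    have h4 : (fun j => b j (x a + 1)) = (fun j => b j (x a)) + (fun j => c j (x a)) := by
      ext j
      simp [← hbc j (x a)]
    rw [h1, h3, h4, Matrix.det_updateRow_add, ← h2]
    ring

theorem shiftAction_prod_sub_one_chooseDet {m : ℕ} (s : ℕ) :
    shiftAction _ (∏ i : Fin m, (shiftVar i - 1)) (chooseDet (s + 1) m) = chooseDet s m := by
  ext x
  have h := shiftAction_prod_sub_one_det
    (fun j : Fin m => fun x : ℤ => ((Ring.choose x ((j : ℕ) + (s + 1)) : ℤ) : ℚ))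
    (fun j : Fin m => fun x : ℤ => ((Ring.choose x ((j : ℕ) + s) : ℤ) : ℚ))
    (fun j x => by
      rw [← add_assoc, Ring.choose_succ_succ]; push_cast; ring) Finset.univ x
  simp only [Finset.mem_univ, if_true] at h
  exact h

theorem factorial_mul_choose_eq_eval (x : ℤ) (j : ℕ) :
    ((j.factorial : ℚ)) * ((Ring.choose x j : ℤ) : ℚ) =
      (descPochhammer ℚ j).eval (x : ℚ) := by
  have h := Ring.descPochhammer_eq_factorial_smul_choose x j
  rw [← descPochhammer_eval_cast]
  rw [← Polynomial.eval_eq_smeval, nsmul_eq_mul] at h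
  rw [h]
  push_cast
  rfl

/-- Scaling column `j` by `j!` gives monic polynomials of degree `j`, whose determinant is the
Vandermonde determinant. -/
theorem prod_factorial_mul_chooseDet {m : ℕ} (x : Fin m → ℤ) :
    (∏ j : Fin m, ((j : ℕ).factorial : ℚ)) * chooseDet 0 m x =
      ∏ e ∈ indexPairs m, ((x e.2 : ℚ) - x e.1) := by
  rw [chooseDet, ← Matrix.det_mul_row]
  have h := Matrix.det_eval_matrixOfPolynomials_eq_det_vandermonde (fun i => (x i : ℚ))
    (fun j : Fin m => descPochhammer ℚ j) (fun i => descPochhammer_natDegree ℚ i)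
    (fun i => monic_descPochhammer ℚ i)
  simp only [Matrix.of_apply, Nat.add_zero, factorial_mul_choose_eq_eval]
  rw [← h, Matrix.det_vandermonde, indexPairs, Finset.prod_filter, ← Finset.univ_product_univ,
    Finset.prod_product]
  refine Finset.prod_congr rfl fun i _ => ?_
  rw [← Finset.prod_filter]
  refine Finset.prod_congr ?_ fun _ _ => rfl
  ext; simp

theorem chooseDet_id (m : ℕ) : chooseDet 0 m (fun i => ((i : ℕ) : ℤ)) = 1 := by
  rw [chooseDet, Matrix.det_of_isLowerTriangular]
  · simp [Ring.choose_natCast]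
  · intro i j hij
    have : (i : ℕ) < j := hij
    simp [Ring.choose_natCast, Nat.choose_eq_zero_of_lt this]

theorem eval_vandermondeQuotient (m : ℕ) (x : Fin m → ℤ) :
    MvPolynomial.eval (fun i => (x i : ℚ)) (vandermondeQuotient m) = chooseDet 0 m x := by
  have h0 : (∏ j : Fin m, ((j : ℕ).factorial : ℚ)) ≠ 0 :=
    Finset.prod_ne_zero_iff.2 fun j _ => Nat.cast_ne_zero.2 (Nat.factorial_ne_zero _)
  have h1 := prod_factorial_mul_chooseDet x
  -- Evaluation at `(0, …, m - 1)`, where the determinant is `1`, identifies the product of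
  -- factorials with the product of the denominators `j - i`.
  have h2 := prod_factorial_mul_chooseDet (fun i : Fin m => ((i : ℕ) : ℤ))
  rw [chooseDet_id, mul_one] at h2
  rw [vandermondeQuotient, map_prod]
  simp only [map_mul, map_sub, MvPolynomial.eval_C, MvPolynomial.eval_X]
  simp only [Int.cast_natCast] at h2
  rw [Finset.prod_mul_distrib, ← h1, Finset.prod_div_distrib, ← h2, Finset.prod_const_one]
  field_simp

/-! ### The polynomial operators act as shifts of the values at lattice points -/

/-- The values of a polynomial at lattice points. -/
noncomputable def latticeEval (n : ℕ) : MvPolynomial (Fin n) ℚ →ₗ[ℚ] ((Fin n → ℤ) → ℚ) where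
  toFun P x := MvPolynomial.eval (fun i => (x i : ℚ)) P
  map_add' P Q := by ext x; simp
  map_smul' c P := by ext x; simp [MvPolynomial.smul_eval]

theorem latticeEval_shiftOp {n : ℕ} (i : Fin n) (P : MvPolynomial (Fin n) ℚ) :
    latticeEval n (shiftOp i P) = shiftAction _ (shiftVar i) (latticeEval n P) := by
  ext x
  rw [shiftAction_shiftVar]
  simp only [latticeEval, shiftOp, LinearMap.coe_mk, AddHom.coe_mk, AlgHom.toLinearMap_apply,
    MvPolynomial.aeval_def, MvPolynomial.eval_eval₂]
  rw [MvPolynomial.eval, MvPolynomial.coe_eval₂Hom]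
  congr 1
  · ext; simp
  · ext j
    by_cases h : j = i
    · subst h; simp
    · simp [h]

theorem latticeEval_factorOp {n : ℕ} (p q : Fin n) (P : MvPolynomial (Fin n) ℚ) :
    latticeEval n (factorOp p q P) = shiftAction _ (shiftFactor p q) (latticeEval n P) := by
  simp only [factorOp, diffOp, shiftFactor, LinearMap.add_apply, Module.End.mul_apply,
    LinearMap.sub_apply, Module.End.one_apply, map_add, map_sub, map_mul, map_one,
    latticeEval_shiftOp]

theorem latticeEval_productOp {n : ℕ} (P : MvPolynomial (Fin n) ℚ) :
    latticeEval n (productOp n P) = shiftAction _ (shiftProduct n) (latticeEval n P) := by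
  classical
  -- The commutation proof is quantified so that the induction hypothesis applies to the smaller set
  -- with its own proof.
  have key : ∀ (s : Finset (Fin n × Fin n))
      (hs : (s : Set (Fin n × Fin n)).Pairwise
        (Function.onFun Commute fun e => factorOp e.1 e.2)),
      latticeEval n (s.noncommProd (fun e => factorOp e.1 e.2) hs P) =
        shiftAction _ (∏ e ∈ s, shiftFactor e.1 e.2) (latticeEval n P) := by
    intro s
    induction s using Finset.induction_on with
    | empty => intro hs; simp
    | insert a s ha ih =>
      intro hs
      rw [Finset.noncommProd_insert_of_notMem _ _ _ _ ha, Module.End.mul_apply,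
        latticeEval_factorOp, ih, Finset.prod_insert ha, map_mul, Module.End.mul_apply]
  exact key _ _

/-- The values of the right hand side of the operator formula. -/
theorem eval_productOp_vandermondeQuotient (n : ℕ) (k : Fin n → ℤ) :
    MvPolynomial.eval (fun i => (k i : ℚ)) (productOp n (vandermondeQuotient n)) =
      shiftAction _ (shiftProduct n) (chooseDet 0 n) k := by
  have h := congrFun (latticeEval_productOp (vandermondeQuotient n)) k
  have h2 : latticeEval n (vandermondeQuotient n) = chooseDet 0 n :=
    funext (eval_vandermondeQuotient n)
  rwa [h2] at h

/-! ### Sums over interlacing rows -/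

/-- The strictly increasing rows that can stand above the row `k` in a monotone triangle. -/
noncomputable def interlacingRows {m : ℕ} (k : Fin (m + 1) → ℤ) : Finset (Fin m → ℤ) :=
  (Fintype.piFinset fun i : Fin m => Finset.Icc (k i.castSucc) (k i.succ)).filter
    fun l => ∀ i j, i < j → l i < l j

theorem mem_interlacingRows {m : ℕ} {k : Fin (m + 1) → ℤ} {l : Fin m → ℤ} :
    l ∈ interlacingRows k ↔
      (∀ i, k i.castSucc ≤ l i ∧ l i ≤ k i.succ) ∧ ∀ i j, i < j → l i < l j := by
  simp [interlacingRows]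

theorem cons_mem_interlacingRows {m : ℕ} {c a : ℤ} {k : Fin (m + 1) → ℤ} {l : Fin m → ℤ} :
    (Fin.cons a l : Fin (m + 1) → ℤ) ∈ interlacingRows (Fin.cons c k : Fin (m + 2) → ℤ) ↔
      (c ≤ a ∧ a ≤ k 0) ∧ l ∈ interlacingRows k ∧ ∀ i, a < l i := by
  simp only [mem_interlacingRows, Fin.forall_fin_succ (n := m), Fin.cons_zero, Fin.cons_succ,
    Fin.castSucc_zero, ← Fin.succ_castSucc, Fin.succ_lt_succ_iff, false_imp_iff,
    Fin.succ_pos, true_imp_iff, true_and, Fin.not_lt_zero]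
  tauto

theorem le_of_mem_interlacingRows {m : ℕ} {k : Fin (m + 1) → ℤ} (hk : StrictMono k)
    {l : Fin m → ℤ} (hl : l ∈ interlacingRows k) (i : Fin m) : k 0 ≤ l i :=
  (hk.monotone (Fin.zero_le _)).trans ((mem_interlacingRows.1 hl).1 i).1

theorem sum_interlacingRows_one {M : Type*} [AddCommMonoid M] (k : Fin 2 → ℤ)
    (f : (Fin 1 → ℤ) → M) :
    ∑ l ∈ interlacingRows k, f l =
      ∑ a ∈ Finset.Icc (k 0) (k 1), f (Fin.cons a Fin.elim0) := by
  refine Finset.sum_bij' (fun l _ => l 0) (fun a _ => Fin.cons a Fin.elim0) ?_ ?_ ?_ ?_ ?_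
  · intro l hl
    exact Finset.mem_Icc.2 ((mem_interlacingRows.1 hl).1 0)
  · intro a ha
    rw [mem_interlacingRows]
    refine ⟨fun i => ?_, fun i j h => absurd h (by omega)⟩
    obtain rfl : i = 0 := Fin.fin_one_eq_zero i
    exact Finset.mem_Icc.1 ha
  · intro l _
    ext i
    obtain rfl : i = 0 := Fin.fin_one_eq_zero i
    rfl
  · intro a _
    rfl
  · intro l _
    congr 1
    ext i
    obtain rfl : i = 0 := Fin.fin_one_eq_zero i
    rfl

/-- Choosing the first entry freely in `[c, d]` breaks strictness only when it and the next entry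
both equal `d`; the second sum on the left accounts for these collisions. -/
theorem sum_interlacingRows_cons_cons {M : Type*} [AddCommMonoid M] {m : ℕ} (c d : ℤ)
    (k : Fin (m + 1) → ℤ) (hk : StrictMono (Fin.cons d k : Fin (m + 2) → ℤ)) (hcd : c < d)
    (f : (Fin (m + 2) → ℤ) → M) :
    ∑ l ∈ interlacingRows (Fin.cons c (Fin.cons d k : Fin (m + 2) → ℤ) : Fin (m + 3) → ℤ), f l +
        ∑ l ∈ interlacingRows k, f (Fin.cons d (Fin.cons d l : Fin (m + 1) → ℤ)) =
      ∑ l ∈ interlacingRows (Fin.cons d k : Fin (m + 2) → ℤ),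
        ∑ a ∈ Finset.Icc c d, f (Fin.cons a l) := by
  have hdk : d < k 0 := hk (Fin.succ_pos 0)
  have hk' : StrictMono k := fun i j h => by
    simpa using hk (Fin.succ_lt_succ_iff.2 h)
  conv_rhs =>
    rw [Finset.sum_sigma', ← Finset.sum_filter_add_sum_filter_not _ (fun p => p.2 < p.1 0)]
  congr 1
  · refine Finset.sum_bij' (fun l _ => ⟨Fin.tail l, l 0⟩) (fun p _ => Fin.cons p.2 p.1)
      ?_ ?_ ?_ ?_ ?_
    · intro l hl
      rw [← Fin.cons_self_tail l, cons_mem_interlacingRows] at hl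
      rw [Finset.mem_filter, Finset.mem_sigma, Finset.mem_Icc]
      exact ⟨⟨hl.2.1, hl.1⟩, hl.2.2 0⟩
    · rintro ⟨l, a⟩ h
      rw [Finset.mem_filter, Finset.mem_sigma, Finset.mem_Icc] at h
      rw [cons_mem_interlacingRows]
      refine ⟨h.1.2, h.1.1, fun i => h.2.trans_le ?_⟩
      rcases eq_or_lt_of_le (Fin.zero_le i) with rfl | hi
      · exact le_rfl
      · exact ((mem_interlacingRows.1 h.1.1).2 _ _ hi).le
    · intro l _
      exact Fin.cons_self_tail l
    · rintro ⟨l, a⟩ _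
      rfl
    · intro l _
      exact congrArg f (Fin.cons_self_tail l).symm
  · have collide : ∀ p : (_ : Fin (m + 1) → ℤ) × ℤ,
        p ∈ ((interlacingRows (Fin.cons d k : Fin (m + 2) → ℤ)).sigma
          fun _ => Finset.Icc c d).filter (fun p => ¬ p.2 < p.1 0) →
        p.2 = d ∧ p.1 = Fin.cons d (Fin.tail p.1) ∧ Fin.tail p.1 ∈ interlacingRows k := by
      rintro ⟨l, a⟩ h
      rw [Finset.mem_filter, Finset.mem_sigma, Finset.mem_Icc] at h
      obtain ⟨⟨hl, -, had⟩, hal⟩ := h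
      dsimp only at hl had hal ⊢
      have h0 : d ≤ l 0 := le_of_mem_interlacingRows hk hl 0
      have hl0 : l 0 = d := by omega
      refine ⟨by omega, ?_, ?_⟩
      · conv_lhs => rw [← Fin.cons_self_tail l, hl0]
      · rw [← Fin.cons_self_tail l, cons_mem_interlacingRows] at hl
        exact hl.2.1
    refine Finset.sum_bij' (fun l _ => ⟨Fin.cons d l, d⟩) (fun p _ => Fin.tail p.1)
      ?_ ?_ ?_ ?_ ?_
    · intro l hl
      rw [Finset.mem_filter, Finset.mem_sigma, Finset.mem_Icc, cons_mem_interlacingRows]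
      exact ⟨⟨⟨⟨le_rfl, hdk.le⟩, hl, fun i =>
        hdk.trans_le (le_of_mem_interlacingRows hk' hl i)⟩, hcd.le, le_rfl⟩, lt_irrefl d⟩
    · intro p hp
      exact (collide p hp).2.2
    · intro l _
      rfl
    · rintro ⟨l, a⟩ hp
      obtain ⟨h1, h2, -⟩ := collide _ hp
      dsimp only at h1 h2 ⊢
      rw [← h2, h1]
    · intro l _
      rfl

/-! ### Telescoping over interlacing rows. -/

theorem sum_Icc_int_sub {M : Type*} [AddCommGroup M] (g : ℤ → M) {c d : ℤ} (h : c ≤ d) :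
    ∑ a ∈ Finset.Icc c d, (g (a + 1) - g a) = g (d + 1) - g c := by
  induction d, h using Int.leInduction with
  | base => simp
  | succ d h ih =>
    have : Finset.Icc c (d + 1) = insert (d + 1) (Finset.Icc c d) := by
      ext a; simp only [Finset.mem_Icc, Finset.mem_insert]; omega
    rw [this, Finset.sum_insert (by simp), ih]
    abel

/-- The product of all differences. -/
noncomputable def diffProduct (m : ℕ) : ShiftRing (Fin m) := ∏ i, (shiftVar i - 1)

theorem shiftAction_diffProduct_cons {m : ℕ} (G : (Fin (m + 1) → ℤ) → ℚ) (a : ℤ)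
    (l : Fin m → ℤ) :
    shiftAction _ (diffProduct (m + 1)) G (Fin.cons a l) =
      shiftAction _ (diffProduct m) (fun y => G (Fin.cons (a + 1) y)) l -
        shiftAction _ (diffProduct m) (fun y => G (Fin.cons a y)) l := by
  have h : diffProduct (m + 1) =
      (shiftVar 0 - 1) *
        AddMonoidAlgebra.mapDomainRingHom ℚ (consZeroHom m) (diffProduct m) := by
    rw [diffProduct, Fin.prod_univ_succ, diffProduct, map_prod]
    congr 1
    refine Finset.prod_congr rfl fun i _ => ?_
    rw [map_sub, map_one, mapDomain_consZeroHom]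
  have hc : (Fin.cons a l + Pi.single 0 1 : Fin (m + 1) → ℤ) = Fin.cons (a + 1) l := by
    ext i
    refine Fin.cases ?_ (fun i => ?_) i <;> simp
  rw [h, map_mul, Module.End.mul_apply, map_sub, map_one, LinearMap.sub_apply, Pi.sub_apply,
    Module.End.one_apply, shiftAction_shiftVar, hc, shiftAction_cons, shiftAction_cons]

/-- Delete the entry with index `j` of `k` and add `1` to all entries to its right. -/
def skipShift {m : ℕ} (j : Fin (m + 1)) (k : Fin (m + 1) → ℤ) : Fin m → ℤ :=
  fun i => if i.castSucc < j then k i.castSucc else k i.succ + 1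

theorem skipShift_zero_cons {m : ℕ} (c : ℤ) (k : Fin (m + 1) → ℤ) :
    skipShift 0 (Fin.cons c k : Fin (m + 2) → ℤ) = fun i => k i + 1 := by
  ext i
  simp [skipShift]

theorem skipShift_succ_cons {m : ℕ} (j : Fin (m + 1)) (c : ℤ) (k : Fin (m + 1) → ℤ) :
    skipShift j.succ (Fin.cons c k : Fin (m + 2) → ℤ) = Fin.cons c (skipShift j k) := by
  ext i
  refine Fin.cases ?_ (fun i => ?_) i
  · simp [skipShift]
  · simp [skipShift, Fin.succ_lt_succ_iff]

/-- The condition that `1 + E_{i+1} (E_i - 1)` applied to `G` vanishes where the coordinates `i`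
and `i + 1` agree. -/
def AdjacentVanishing {m : ℕ} (G : (Fin m → ℤ) → ℚ) : Prop :=
  ∀ i j : Fin m, (j : ℕ) = i + 1 → ∀ x, x i = x j → shiftAction _ (shiftFactor j i) G x = 0

theorem AdjacentVanishing.cons {m : ℕ} {G : (Fin (m + 1) → ℤ) → ℚ} (hG : AdjacentVanishing G)
    (c : ℤ) : AdjacentVanishing fun y => G (Fin.cons c y) := by
  intro i j hij x hx
  rw [← shiftAction_cons, mapDomain_shiftFactor, mapDomain_consZeroHom, mapDomain_consZeroHom]
  exact hG i.succ j.succ (by simp [hij]) _ (by simpa using hx)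

theorem AdjacentVanishing.zero_one {m : ℕ} {G : (Fin (m + 2) → ℤ) → ℚ}
    (hG : AdjacentVanishing G) (d : ℤ) (l : Fin m → ℤ) :
    G (Fin.cons d (Fin.cons d l : Fin (m + 1) → ℤ)) +
      G (Fin.cons (d + 1) (Fin.cons (d + 1) l : Fin (m + 1) → ℤ)) -
      G (Fin.cons d (Fin.cons (d + 1) l : Fin (m + 1) → ℤ)) = 0 := by
  have h := hG 0 1 (by simp) (Fin.cons d (Fin.cons d l : Fin (m + 1) → ℤ)) rfl
  rw [shiftAction_shiftFactor] at h
  have h1 : (Fin.cons d (Fin.cons d l : Fin (m + 1) → ℤ) + Pi.single 1 1 : Fin (m + 2) → ℤ) =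
      Fin.cons d (Fin.cons (d + 1) l : Fin (m + 1) → ℤ) := by
    ext i
    refine Fin.cases ?_ (fun i => Fin.cases ?_ (fun i => ?_) i) i
    · simp
    · simp
    · simp [Fin.ext_iff]
  have h2 : (Fin.cons d (Fin.cons (d + 1) l : Fin (m + 1) → ℤ) + Pi.single 0 1 :
      Fin (m + 2) → ℤ) = Fin.cons (d + 1) (Fin.cons (d + 1) l : Fin (m + 1) → ℤ) := by
    ext i
    refine Fin.cases ?_ (fun i => ?_) i <;> simp
  rwa [h1, h2] at h

/-- Telescoping sum over interlacing rows. -/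
theorem sum_interlacingRows_diffProduct : ∀ (m : ℕ) (k : Fin (m + 1) → ℤ), StrictMono k →
    ∀ G : (Fin m → ℤ) → ℚ, AdjacentVanishing G →
      ∑ l ∈ interlacingRows k, shiftAction _ (diffProduct m) G l =
        ∑ j : Fin (m + 1), (-1) ^ (j : ℕ) * G (skipShift j k)
  | 0, k, _, G, _ => by
    have : interlacingRows k = {Fin.elim0} := by
      ext l
      simp only [mem_interlacingRows, Finset.mem_singleton, Subsingleton.elim l Fin.elim0,
        iff_true]
      exact ⟨fun i => i.elim0, fun i => i.elim0⟩
    rw [this, Finset.sum_singleton, Fin.sum_univ_one]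
    simp [diffProduct, Subsingleton.elim (skipShift 0 k) Fin.elim0]
  | 1, k, hk, G, _ => by
    have h01 : k 0 ≤ k 1 := hk.monotone (Fin.zero_le _)
    rw [sum_interlacingRows_one]
    simp only [shiftAction_diffProduct_cons]
    rw [sum_Icc_int_sub (fun a => shiftAction _ (diffProduct 0)
      (fun y => G (Fin.cons a y)) Fin.elim0) h01, Fin.sum_univ_two]
    have h0 : (Fin.cons (k 1 + 1) Fin.elim0 : Fin 1 → ℤ) = skipShift 0 k := by
      ext i
      obtain rfl : i = 0 := Fin.fin_one_eq_zero i
      simp [skipShift]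
    have h1 : (Fin.cons (k 0) Fin.elim0 : Fin 1 → ℤ) = skipShift 1 k := by
      ext i
      obtain rfl : i = 0 := Fin.fin_one_eq_zero i
      simp [skipShift]
    simp [diffProduct, h0, h1, sub_eq_add_neg]
  | m + 2, k, hk, G, hG => by
    obtain ⟨c, k, rfl⟩ : ∃ c k', k = Fin.cons c k' := ⟨k 0, Fin.tail k, (Fin.cons_self_tail k).symm⟩
    obtain ⟨d, k, rfl⟩ : ∃ d k', k = Fin.cons d k' := ⟨k 0, Fin.tail k, (Fin.cons_self_tail k).symm⟩
    have hcd : c < d := hk (Fin.succ_pos 0)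
    have hk1 : StrictMono (Fin.cons d k : Fin (m + 2) → ℤ) := fun i j h => by
      simpa using hk (Fin.succ_lt_succ_iff.2 h)
    have hk2 : StrictMono k := fun i j h => by
      simpa using hk1 (Fin.succ_lt_succ_iff.2 h)
    have hsum := sum_interlacingRows_cons_cons c d k hk1 hcd
      (shiftAction _ (diffProduct (m + 2)) G)
    -- Of the four values given by the first two differences, three cancel by `zero_one`; only the
    -- one at `(d + 1, d)` survives, with a minus sign.
    have hdiag : ∀ l : Fin m → ℤ, shiftAction _ (diffProduct (m + 2)) G
        (Fin.cons d (Fin.cons d l : Fin (m + 1) → ℤ)) =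
        - shiftAction _ (diffProduct m)
          (fun y => G (Fin.cons (d + 1) (Fin.cons d y : Fin (m + 1) → ℤ))) l := by
      intro l
      rw [shiftAction_diffProduct_cons, shiftAction_diffProduct_cons,
        shiftAction_diffProduct_cons, ← Pi.neg_apply, ← map_neg]
      simp only [← Pi.sub_apply, ← map_sub]
      refine congrArg (fun g => shiftAction _ (diffProduct m) g l) (funext fun y => ?_)
      have := hG.zero_one d y
      simp only [Pi.sub_apply, Pi.neg_apply]
      linarith
    have htel : ∀ l : Fin (m + 1) → ℤ,
        ∑ a ∈ Finset.Icc c d, shiftAction _ (diffProduct (m + 2)) G (Fin.cons a l) =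
        shiftAction _ (diffProduct (m + 1)) (fun y => G (Fin.cons (d + 1) y)) l -
          shiftAction _ (diffProduct (m + 1)) (fun y => G (Fin.cons c y)) l := by
      intro l
      simp only [shiftAction_diffProduct_cons G]
      exact sum_Icc_int_sub (fun a => shiftAction _ (diffProduct (m + 1))
        (fun y => G (Fin.cons a y)) l) hcd.le
    simp only [hdiag, htel, Finset.sum_sub_distrib, Finset.sum_neg_distrib] at hsum
    rw [sum_interlacingRows_diffProduct (m + 1) _ hk1 _ (hG.cons _),
      sum_interlacingRows_diffProduct (m + 1) _ hk1 _ (hG.cons _),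
      sum_interlacingRows_diffProduct m _ hk2 _ ((hG.cons _).cons _)] at hsum
    -- The term `j = 0` split off here is the term `j = 0` of the goal; the rest of this sum cancels
    -- against the collision sum. The sum with first entry `c` supplies the goal's terms `j ≥ 1`.
    rw [Fin.sum_univ_succ (fun j => (-1) ^ (j : ℕ) *
      G (Fin.cons (d + 1) (skipShift j (Fin.cons d k : Fin (m + 2) → ℤ))))] at hsum
    rw [Fin.sum_univ_succ]
    simp only [skipShift_zero_cons, skipShift_succ_cons, Fin.val_succ, pow_succ, Fin.val_zero,
      pow_zero, one_mul, mul_neg, mul_one, neg_mul, Finset.sum_neg_distrib] at hsum ⊢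
    have h0 : (fun i => (Fin.cons d k : Fin (m + 2) → ℤ) i + 1) =
        Fin.cons (d + 1) (fun i => k i + 1) := by
      ext i
      refine Fin.cases ?_ (fun i => ?_) i <;> simp
    rw [h0]
    linarith

/-! ### The recursion for the right hand side of the operator formula -/

theorem adjacentVanishing_shiftProduct_chooseDet (s m : ℕ) :
    AdjacentVanishing (shiftAction _ (shiftProduct m) (chooseDet s m)) := by
  intro i j hij x hx
  obtain ⟨m, rfl⟩ : ∃ m', m = m' + 1 := ⟨m - 1, by have := i.2; omega⟩
  have hi : (i : ℕ) < m := by have := j.2; omega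
  obtain ⟨i, rfl⟩ : ∃ i' : Fin m, i = i'.castSucc := ⟨⟨i, hi⟩, rfl⟩
  obtain rfl : j = i.succ := Fin.ext hij
  refine shiftFactor_shiftProduct_eq_zero _ _ (fun y => ?_) x hx
  rw [chooseDet_comp_perm, Equiv.Perm.sign_swap (Fin.castSucc_lt_succ).ne]
  simp

/-- Both sides equal the alternating sum of `G (skipShift j k)` for `G = P_m D_1`: the right by
telescoping, the left by expanding the determinant. -/
theorem shiftProduct_chooseDet_succ {m : ℕ} (k : Fin (m + 1) → ℤ) (hk : StrictMono k) :
    shiftAction _ (shiftProduct (m + 1)) (chooseDet 0 (m + 1)) k =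
      ∑ l ∈ interlacingRows k, shiftAction _ (shiftProduct m) (chooseDet 0 m) l := by
  have h0 : shiftAction _ (shiftProduct m) (chooseDet 0 m) =
      shiftAction _ (diffProduct m) (shiftAction _ (shiftProduct m) (chooseDet 1 m)) := by
    rw [← Module.End.mul_apply, ← map_mul, mul_comm, map_mul, Module.End.mul_apply, diffProduct,
      shiftAction_prod_sub_one_chooseDet]
  rw [h0, sum_interlacingRows_diffProduct m k hk _ (adjacentVanishing_shiftProduct_chooseDet 1 m)]
  have h1 : chooseDet 0 (m + 1) = ∑ j : Fin (m + 1),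
      (-1 : ℚ) ^ (j : ℕ) • fun y : Fin (m + 1) → ℤ => chooseDet 1 m (y ∘ j.succAbove) := by
    ext y
    simp [chooseDet_succ]
  rw [h1, map_sum, Finset.sum_apply]
  refine Finset.sum_congr rfl fun j _ => ?_
  rw [map_smul, Pi.smul_apply, smul_eq_mul, shiftAction_reindex, mapDomain_shiftProduct, map_mul,
    Module.End.mul_apply, shiftAction_prod_shiftVar]
  congr 1
  -- The surviving shifts `E_q`, `q > j`, are the `+ 1` in `skipShift`.
  refine congrArg _ (funext fun i => ?_)
  simp only [skipShift, Pi.add_apply, Function.comp_apply, Finset.mem_filter, Finset.mem_univ,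
    true_and, Fin.lt_succAbove_iff_le_castSucc]
  by_cases h : i.castSucc < j
  · simp [h, Fin.succAbove_of_castSucc_lt _ _ h, h.not_ge]
  · simp [h, Fin.succAbove_of_le_castSucc _ _ (not_lt.1 h), not_lt.1 h]

/-! ### The recursion for monotone triangles -/

/-- Removing the bottom row. -/
def MonotoneTriangle.init {n : ℕ} (T : MonotoneTriangle (n + 1)) : MonotoneTriangle n where
  entry i j := T.entry i.castSucc j
  row_lt i j := T.row_lt i.castSucc j
  northeast i h j := T.northeast i (h.trans (Nat.lt_succ_self n)) j
  southeast i h j := T.southeast i (h.trans (Nat.lt_succ_self n)) j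

/-- Adding a bottom row. -/
def MonotoneTriangle.snoc {n : ℕ} (T : MonotoneTriangle n) (k : Fin (n + 1) → ℤ)
    (hk : StrictMono k) (l : Fin n → ℤ) (hT : T ∈ monotoneTriangles n l)
    (hl : l ∈ interlacingRows k) : MonotoneTriangle (n + 1) where
  entry i j := if h : (i : ℕ) < n then T.entry ⟨i, h⟩ j else k ⟨j, by omega⟩
  row_lt i j := by
    by_cases h : (i : ℕ) < n
    · simpa only [h, dif_pos] using T.row_lt ⟨i, h⟩ j
    · simp only [h, dif_neg, not_false_eq_true]
      exact hk (by simp [Fin.lt_def])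
  northeast i h j := by
    have hi : i < n := by omega
    by_cases h' : i + 1 < n
    · simpa only [h', hi, dif_pos] using T.northeast i h' j
    · have hin : i + 1 = n := by omega
      have hj := hT ⟨i, hi⟩ hin j
      simp only [h', hi, dif_pos, dif_neg, not_false_eq_true]
      rw [hj]
      exact ((mem_interlacingRows.1 hl).1 _).1
  southeast i h j := by
    have hi : i < n := by omega
    by_cases h' : i + 1 < n
    · simpa only [h', hi, dif_pos] using T.southeast i h' j
    · have hin : i + 1 = n := by omega
      have hj := hT ⟨i, hi⟩ hin j
      simp only [h', hi, dif_pos, dif_neg, not_false_eq_true]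
      rw [hj]
      exact ((mem_interlacingRows.1 hl).1 _).2

theorem MonotoneTriangle.exists_bottomRow : ∀ {n : ℕ} (T : MonotoneTriangle n),
    ∃ l, T ∈ monotoneTriangles n l
  | 0, _ => ⟨Fin.elim0, fun i => i.elim0⟩
  | n + 1, T => ⟨T.entry (Fin.last n), fun i h j => by
      obtain rfl : i = Fin.last n := Fin.ext (Nat.succ_injective h)
      rfl⟩

theorem eq_of_mem_monotoneTriangles : ∀ {n : ℕ} {T : MonotoneTriangle n} {l l' : Fin n → ℤ},
    T ∈ monotoneTriangles n l → T ∈ monotoneTriangles n l' → l = l'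
  | 0, _, _, _, _, _ => Subsingleton.elim _ _
  | n + 1, _, _, _, h, h' => funext fun j =>
      (h (Fin.last n) rfl j).symm.trans (h' (Fin.last n) rfl j)

theorem MonotoneTriangle.mem_interlacingRows_of_init {n : ℕ} {T : MonotoneTriangle (n + 1)}
    {k : Fin (n + 1) → ℤ} (hT : T ∈ monotoneTriangles (n + 1) k) {l : Fin n → ℤ}
    (hl : T.init ∈ monotoneTriangles n l) : l ∈ interlacingRows k := by
  rw [mem_interlacingRows]
  rcases n with _ | n
  · exact ⟨fun i => i.elim0, fun i => i.elim0⟩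
  · have hl' : ∀ j : Fin (n + 1), T.entry (Fin.last n).castSucc j = l j :=
      fun j => hl (Fin.last n) rfl j
    have hk' : ∀ j : Fin (n + 2), T.entry (Fin.last (n + 1)) j = k j :=
      fun j => hT (Fin.last (n + 1)) rfl j
    refine ⟨fun i => ?_, ?_⟩
    · rw [← hl', ← hk', ← hk']
      exact ⟨T.northeast n (Nat.lt_succ_self _) i, T.southeast n (Nat.lt_succ_self _) i⟩
    · have hmono : StrictMono l := Fin.strictMono_iff_lt_succ.2 fun i => by
        rw [← hl', ← hl']
        exact T.row_lt (Fin.last n).castSucc i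
      exact fun i j h => hmono h

theorem init_injOn_monotoneTriangles {n : ℕ} (k : Fin (n + 1) → ℤ) :
    Set.InjOn MonotoneTriangle.init (monotoneTriangles (n + 1) k) := by
  intro T hT T' hT' h
  ext i j
  rcases Fin.eq_castSucc_or_eq_last i with ⟨i, rfl⟩ | rfl
  · exact congrFun (congrFun (congrArg MonotoneTriangle.entry h) i) j
  · exact (hT (Fin.last n) rfl j).trans (hT' (Fin.last n) rfl j).symm

/-- Together with injectivity of `init`, this makes the count additive over the possible penultimate
rows. -/
theorem image_init_monotoneTriangles {n : ℕ} (k : Fin (n + 1) → ℤ) (hk : StrictMono k) :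
    MonotoneTriangle.init '' monotoneTriangles (n + 1) k =
      ⋃ l ∈ interlacingRows k, monotoneTriangles n l := by
  ext T
  simp only [Set.mem_image, Set.mem_iUnion, exists_prop]
  constructor
  · rintro ⟨T, hT, rfl⟩
    obtain ⟨l, hl⟩ := T.init.exists_bottomRow
    exact ⟨l, T.mem_interlacingRows_of_init hT hl, hl⟩
  · rintro ⟨l, hl, hT⟩
    refine ⟨T.snoc k hk l hT hl, fun i h j => ?_, ?_⟩
    · have hi : ¬ (i : ℕ) < n := by omega
      simp only [MonotoneTriangle.snoc, hi, dif_neg, not_false_eq_true]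
      rfl
    · ext i j
      simp [MonotoneTriangle.init, MonotoneTriangle.snoc]

theorem theorem1 (n : ℕ) (k : Fin n → ℤ) (hk : StrictMono k) :
    (monotoneTriangles n k).Finite ∧
      ((monotoneTriangles n k).ncard : ℚ) =
        MvPolynomial.eval (fun i => (k i : ℚ)) (productOp n (vandermondeQuotient n)) := by
  rw [eval_productOp_vandermondeQuotient]
  induction n with
  | zero =>
    have huniv : monotoneTriangles 0 k = {⟨fun i => i.elim0, fun i => i.elim0,
        fun i h => absurd h (by omega), fun i h => absurd h (by omega)⟩} := by
      ext T
      simp only [Set.mem_singleton_iff]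
      refine ⟨fun _ => ?_, fun _ i => i.elim0⟩
      ext i
      exact i.elim0
    rw [huniv]
    refine ⟨Set.finite_singleton _, ?_⟩
    simp [shiftProduct, indexPairs, chooseDet]
  | succ n ih =>
    have hrow : ∀ l ∈ interlacingRows k, StrictMono l := fun l hl i j h =>
      (mem_interlacingRows.1 hl).2 i j h
    have himage := image_init_monotoneTriangles k hk
    have hinj := init_injOn_monotoneTriangles k
    refine ⟨Set.Finite.of_finite_image ?_ hinj, ?_⟩
    · rw [himage]
      exact (interlacingRows k).finite_toSet.biUnion fun l hl => (ih l (hrow l hl)).1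
    · have hcard := (interlacingRows k).finite_toSet.ncard_biUnion
        (fun l hl => (ih l (hrow l hl)).1) (fun l _ l' _ hne =>
          Set.disjoint_left.2 fun T hT hT' => hne (eq_of_mem_monotoneTriangles hT hT'))
      simp only [Finset.mem_coe] at hcard
      rw [shiftProduct_chooseDet_succ k hk, ← hinj.ncard_image, himage, hcard,
        finsum_mem_finset_eq_sum]
      push_cast
      exact Finset.sum_congr rfl fun l hl => (ih l (hrow l hl)).2
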